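/- Theorem 8. A configuration on a finite connected graph $G$ is a function $C:V(G)\to\mathbb{N}\cup\{0\}$; it has $\sum_v C(v)$ pebbles. A pebbling move removes two pebbles from a vertex and places one of them on an adjacent vertex. A set $D\subseteq V(G)$ is dominating if every vertex of $G$ is in $D$ or adjacent to an element of $D$. The domination cover pebbling number $\psi(G)$ is the least $N$ such that every configuration of $N$ pebbles on $G$ can be transformed, by a (possibly empty) finite sequence of pebbling moves, into a configuration for which the set of vertices carrying at least one pebble is dominating. Let $B_n$ be the complete binary tree of height $n$: it has $2^i$ vertices at distance $i$ from the root for $0\le i\le n$, and every vertex at distance less than $n$ from the root has exactly two children. Then for every integer $n\ge 2$, $$\psi(B_n)=(2^{n-1}-1)+\sum_{i=0}^{\lfloor (n-1)/3\rfloor}\Bigl(2^{3i+1}+\sum_{j=1}^{n-3i-2}2^{j-1}\,2^{3i+2j+1}\Bigr)+\sum_{k=1}^{\lfloor (n+1)/3\rfloor}2^{n-3k+1}\,2^{2n-3k+2}+\gamma_n,$$ where $\gamma_n=2^{n-1}$ if $n\equiv 0\pmod 3$ and $\gamma_n=0$ otherwise, and a sum whose upper limit is smaller than its lower limit is $0$.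 -/

import Mathlib

section Pebbling

variable {V : Type*}

/-- A pebbling move from the configuration `C` to the configuration `C'`: two pebbles are removed
from some vertex `u`, and one of them is placed on a neighbour `v` of `u`. -/
def PebblingMove (G : SimpleGraph V) (C C' : V → ℕ) : Prop :=
  ∃ u v : V, G.Adj u v ∧ C u = C' u + 2 ∧ C' v = C v + 1 ∧ ∀ w : V, w ≠ u → w ≠ v → C' w = C w

/-- `D` is a dominating set of `G`: every vertex is in `D` or adjacent to some element of `D`. -/
def IsDominatingSet (G : SimpleGraph V) (D : Set V) : Prop :=
  ∀ v : V, v ∈ D ∨ ∃ u ∈ D, G.Adj v u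

/-- The configuration `C` can be transformed, by a (possibly empty) finite sequence of pebbling
moves, into a configuration whose set of pebbled vertices is a dominating set. -/
def HasDominationCoverSolution (G : SimpleGraph V) (C : V → ℕ) : Prop :=
  ∃ C' : V → ℕ, Relation.ReflTransGen (PebblingMove G) C C' ∧
    IsDominatingSet G {v : V | 0 < C' v}

/-- The domination cover pebbling number `ψ(G)`: the least `N` such that every configuration of
`N` pebbles has a domination cover solution. -/
noncomputable def dominationCoverPebblingNumber [Fintype V] (G : SimpleGraph V) : ℕ :=
  sInf {N : ℕ | ∀ C : V → ℕ, ∑ v : V, C v = N → HasDominationCoverSolution G C}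

end Pebbling

/-- A vertex of the complete binary tree of height `n`, given by the sequence of left/right choices
on the path leading to it from the root; the root is the empty sequence, and the length of the
sequence is the distance from the root. -/
abbrev BinaryTreeVertex (n : ℕ) : Type := {l : List Bool // l.length ≤ n}

noncomputable instance BinaryTreeVertex.instFintype (n : ℕ) : Fintype (BinaryTreeVertex n) :=
  (List.finite_length_le Bool n).fintype

/-- The complete binary tree `B_n` of height `n`: `l` is the parent of `l ++ [b]`. -/
def completeBinaryTree (n : ℕ) : SimpleGraph (BinaryTreeVertex n) where
  Adj u v := (∃ b : Bool, v.1 = u.1 ++ [b]) ∨ (∃ b : Bool, u.1 = v.1 ++ [b])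
  symm := ⟨fun _ _ h => h.symm⟩
  loopless := ⟨fun u h => by simp at h⟩

/-! Solvability on a rooted tree is decided by a recursion from the leaves. For each demand on the
root (pebbled, dominated, or free), `surplus` records how many pebbles can be spared there, or are
missing, once everything below is covered. A branch with surplus `x ≥ 0` sends `x / 2` pebbles up; a
deficit `-x` costs `-2x` pebbles of the parent. No move raises the surplus and a covered
configuration has a nonnegative one, while an optimal strategy realizes the recursion. So a
configuration is solvable exactly when its surplus in the state `dominated` is nonnegative
(`hasDominationCoverSolution_iff`), and the rest is arithmetic.

The worst configuration wastes one pebble on a leaf of each sibling pair and piles the rest on one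
leaf, which must pay for the vertices at height 1 modulo 3. This set leaves the root undominated
exactly when 3 divides `n`; one more pebble on a child of the root then costs `2 ^ (n - 1)` from the
leaf, and this is `γ_n`. `exists_surplus_dominated_neg` shows that this configuration, one pebble
short, fails.

For the upper bound, `IsGainBound` grants `2 ^ (m - 1)` wasted pebbles and bounds the gain from the
others by a subadditive function. Subadditivity lets the gains of two branches be replaced by that
of a single branch, so stacking is extremal, and the bound passes from one height to the next
(`IsGainBound.succ`). The threshold obtained is summed in closed form by comparing recurrences
(`leafThreshold_add_one`). -/

/-! ### Configurations on the infinite binary tree -/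

/-- The part of a configuration lying on the subtree of the child `b` of the root. -/
def branch (C : List Bool → ℕ) (b : Bool) : List Bool → ℕ := fun l => C (b :: l)

/-- The configuration with `r` pebbles on the root and `F b` on the subtree of the child `b`. -/
def graft (r : ℕ) (F : Bool → List Bool → ℕ) : List Bool → ℕ
  | [] => r
  | b :: l => F b l

@[simp] theorem graft_nil (r : ℕ) (F : Bool → List Bool → ℕ) : graft r F [] = r := rfl

@[simp] theorem graft_cons (r : ℕ) (F : Bool → List Bool → ℕ) (b : Bool) (l : List Bool) :
    graft r F (b :: l) = F b l := rfl

@[simp] theorem branch_graft (r : ℕ) (F : Bool → List Bool → ℕ) (b : Bool) :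
    branch (graft r F) b = F b := rfl

theorem graft_branch (C : List Bool → ℕ) : graft (C []) (branch C) = C := by
  funext l; cases l <;> rfl

/-- The number of pebbles on the vertices of depth at most `n`. -/
def pebbleCount : ℕ → (List Bool → ℕ) → ℕ
  | 0, C => C []
  | n + 1, C => C [] + pebbleCount n (branch C false) + pebbleCount n (branch C true)

/-- The vertices of `B_{n+1}` are the root and the vertices of two copies of `B_n`. -/
def binaryTreeVertexSuccEquiv (n : ℕ) :
    Option (Bool × BinaryTreeVertex n) ≃ BinaryTreeVertex (n + 1) where
  toFun
    | none => ⟨[], by simp⟩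
    | some (b, l) => ⟨b :: l.1, by simpa using l.2⟩
  invFun
    | ⟨[], _⟩ => none
    | ⟨b :: l, h⟩ => some (b, ⟨l, by simpa using h⟩)
  left_inv := by rintro (_ | ⟨b, l, h⟩) <;> rfl
  right_inv := by rintro ⟨_ | ⟨b, l⟩, h⟩ <;> rfl

theorem sum_eq_pebbleCount (n : ℕ) (C : List Bool → ℕ) :
    ∑ v : BinaryTreeVertex n, C v.1 = pebbleCount n C := by
  induction n generalizing C with
  | zero =>
    have : Unique (BinaryTreeVertex 0) :=
      ⟨⟨⟨[], by simp⟩⟩, fun v => Subtype.ext (List.length_eq_zero_iff.mp (Nat.le_zero.mp v.2))⟩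
    rw [Fintype.sum_unique]
    have h : (default : BinaryTreeVertex 0).1 = [] :=
      List.length_eq_zero_iff.mp (Nat.le_zero.mp (default : BinaryTreeVertex 0).2)
    rw [h]; rfl
  | succ n ih =>
    rw [← Fintype.sum_equiv (binaryTreeVertexSuccEquiv n)
      (fun x => C (binaryTreeVertexSuccEquiv n x).1) _ (fun _ => rfl), Fintype.sum_option,
      Fintype.sum_prod_type, Fintype.sum_bool]
    have h : ∀ b : Bool, ∑ v : BinaryTreeVertex n, C (binaryTreeVertexSuccEquiv n (some (b, v))).1
        = pebbleCount n (branch C b) := fun b => ih (branch C b)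
    rw [h, h]
    change C [] + _ = _
    simp only [pebbleCount]
    ring

/-- A pebbling move between vertices of depth at most `n` of the infinite binary tree. -/
def TreeMove (n : ℕ) (C C' : List Bool → ℕ) : Prop :=
  ∃ u v : List Bool, u.length ≤ n ∧ v.length ≤ n ∧
    ((∃ b, v = u ++ [b]) ∨ ∃ b, u = v ++ [b]) ∧
    C u = C' u + 2 ∧ C' v = C v + 1 ∧ ∀ w, w ≠ u → w ≠ v → C' w = C w

/-- Reachability by moves between vertices of depth at most `n`. -/
abbrev TreeReach (n : ℕ) : (List Bool → ℕ) → (List Bool → ℕ) → Prop :=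
  Relation.ReflTransGen (TreeMove n)

theorem TreeMove.graft_update {n : ℕ} {L L' : List Bool → ℕ} (h : TreeMove n L L') (r : ℕ)
    (F : Bool → List Bool → ℕ) (b : Bool) :
    TreeMove (n + 1) (graft r (Function.update F b L)) (graft r (Function.update F b L')) := by
  obtain ⟨u, v, hu, hv, hadj, h1, h2, h3⟩ := h
  refine ⟨b :: u, b :: v, by simpa using hu, by simpa using hv, ?_, by simpa using h1,
    by simpa using h2, ?_⟩
  · rcases hadj with ⟨c, rfl⟩ | ⟨c, rfl⟩
    · exact Or.inl ⟨c, rfl⟩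
    · exact Or.inr ⟨c, rfl⟩
  · rintro (_ | ⟨c, w⟩) hwu hwv
    · rfl
    · by_cases hc : c = b
      · subst hc
        simpa using h3 w (by simpa using hwu) (by simpa using hwv)
      · simp [Function.update_of_ne hc]

theorem TreeReach.graft_update {n : ℕ} {L L' : List Bool → ℕ} (h : TreeReach n L L') (r : ℕ)
    (F : Bool → List Bool → ℕ) (b : Bool) :
    TreeReach (n + 1) (graft r (Function.update F b L)) (graft r (Function.update F b L')) :=
  Relation.ReflTransGen.lift (fun D => graft r (Function.update F b D))
    (fun _ _ hm => TreeMove.graft_update hm r F b) _ _ h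

/-- The configuration with `k` pebbles on the root and agreeing with `C` elsewhere. -/
abbrev setRoot (C : List Bool → ℕ) (k : ℕ) : List Bool → ℕ := graft k (branch C)

theorem setRoot_self (C : List Bool → ℕ) : setRoot C (C []) = C := graft_branch C

theorem treeReach_push_down (n r : ℕ) (F : Bool → List Bool → ℕ) (b : Bool) (D : List Bool → ℕ)
    (a k : ℕ) :
    TreeReach (n + 1) (graft (r + 2 * k) (Function.update F b (setRoot D a)))
      (graft r (Function.update F b (setRoot D (a + k)))) := by
  induction k generalizing a with
  | zero => exact Relation.ReflTransGen.refl
  | succ k ih =>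
    refine Relation.ReflTransGen.head ⟨[], [b], by simp, by simp, Or.inl ⟨b, rfl⟩, ?_, ?_, ?_⟩
      ((ih (a + 1)).trans (by rw [add_right_comm, add_assoc]))
    · simp only [graft_nil]; ring
    · simp
    · rintro (_ | ⟨c, _ | ⟨d, w⟩⟩) hwu hwv
      · exact absurd rfl hwu
      · have hc : c ≠ b := by rintro rfl; exact hwv rfl
        simp [Function.update_of_ne hc]
      · by_cases hc : c = b
        · subst hc; simp
        · simp [Function.update_of_ne hc]

theorem treeReach_push_up (n r : ℕ) (F : Bool → List Bool → ℕ) (b : Bool) (D : List Bool → ℕ)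
    (a k : ℕ) :
    TreeReach (n + 1) (graft r (Function.update F b (setRoot D (a + 2 * k))))
      (graft (r + k) (Function.update F b (setRoot D a))) := by
  induction k generalizing r with
  | zero => exact Relation.ReflTransGen.refl
  | succ k ih =>
    refine Relation.ReflTransGen.head ⟨[b], [], by simp, by simp, Or.inr ⟨b, rfl⟩, ?_, ?_, ?_⟩
      ((ih (r + 1)).trans (by rw [add_right_comm, add_assoc]))
    · simp only [graft_cons, Function.update_self, graft_nil]; ring
    · simp
    · rintro (_ | ⟨c, _ | ⟨d, w⟩⟩) hwu hwv
      · exact absurd rfl hwv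
      · have hc : c ≠ b := by rintro rfl; exact hwu rfl
        simp [Function.update_of_ne hc]
      · by_cases hc : c = b
        · subst hc; simp
        · simp [Function.update_of_ne hc]

/-! ### The surplus of a configuration -/

/-- What is asked of the root when all other vertices are to be dominated. -/
inductive RootState
  | pebbled
  | dominated
  | free

open RootState

/-- The change at a vertex caused by a child whose subtree has surplus `x`: a surplus is moved up,
a deficit is made up from above. -/
def edgeTransfer (x : ℤ) : ℤ := if 0 ≤ x then x / 2 else 2 * x

theorem edgeTransfer_mono {x y : ℤ} (h : x ≤ y) : edgeTransfer x ≤ edgeTransfer y := by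
  unfold edgeTransfer; split_ifs <;> omega

theorem edgeTransfer_nonneg {x : ℤ} (h : 0 ≤ x) : 0 ≤ edgeTransfer x := by
  unfold edgeTransfer; split_ifs; omega

/-- The surplus at a vertex with `r` pebbles from the surpluses `x`, `y` of its two branches. -/
def combineSurplus (r : ℤ) (x y : RootState → ℤ) : RootState → ℤ
  | pebbled => r - 1 + edgeTransfer (x free) + edgeTransfer (y free)
  | dominated => max (r - 1 + edgeTransfer (x free) + edgeTransfer (y free))
      (max (r + edgeTransfer (x pebbled) + edgeTransfer (y dominated))
        (r + edgeTransfer (x dominated) + edgeTransfer (y pebbled)))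
  | free => max (max (r - 1 + edgeTransfer (x free) + edgeTransfer (y free))
      (max (r + edgeTransfer (x pebbled) + edgeTransfer (y dominated))
        (r + edgeTransfer (x dominated) + edgeTransfer (y pebbled))))
      (r + edgeTransfer (x dominated) + edgeTransfer (y dominated))

/-- The number of pebbles that can be spared at the root of the tree of height `n` once its other
vertices are dominated and the root is in the given state; minus the number missing at the root if
negative. -/
def surplus : ℕ → (List Bool → ℕ) → RootState → ℤ
  | 0, C, pebbled => C [] - 1
  | 0, C, dominated => C [] - 1
  | 0, C, free => C []
  | n + 1, C, σ =>
    combineSurplus (C []) (surplus n (branch C false)) (surplus n (branch C true)) σ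

theorem combineSurplus_add (r k : ℤ) (x y : RootState → ℤ) (σ : RootState) :
    combineSurplus (r + k) x y σ = combineSurplus r x y σ + k := by
  cases σ <;> simp only [combineSurplus] <;> omega

theorem combineSurplus_mono {r s : ℤ} {x y x' y' : RootState → ℤ} (k l : ℤ)
    (hx : ∀ σ, edgeTransfer (x σ) ≤ edgeTransfer (x' σ) + k)
    (hy : ∀ σ, edgeTransfer (y σ) ≤ edgeTransfer (y' σ) + l) (h : r + k + l ≤ s) (σ : RootState) :
    combineSurplus r x y σ ≤ combineSurplus s x' y' σ := by
  have := hx pebbled; have := hx dominated; have := hx free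
  have := hy pebbled; have := hy dominated; have := hy free
  cases σ <;> simp only [combineSurplus] <;> omega

theorem surplus_eq_of_branch_eq {n : ℕ} {C C' : List Bool → ℕ} {k : ℤ}
    (hb : branch C' = branch C) (hr : (C' [] : ℤ) = C [] + k) (σ : RootState) :
    surplus n C' σ = surplus n C σ + k := by
  cases n with
  | zero => cases σ <;> simp only [surplus] <;> omega
  | succ n => simp only [surplus, hb, hr, combineSurplus_add]

/-- The transfer rule is the best exchange rate along an edge: a pebble sent down costs 2 and
improves the transfer by at most 2, and a pebble sent up lowers the transfer by at least 1. Moves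
inside a branch are handled by induction. -/
theorem TreeMove.surplus_le {n : ℕ} {C C' : List Bool → ℕ} (h : TreeMove n C C')
    (σ : RootState) : surplus n C' σ ≤ surplus n C σ := by
  induction n generalizing C C' σ with
  | zero =>
    obtain ⟨u, v, hu, hv, hadj, -⟩ := h
    rcases hadj with ⟨b, rfl⟩ | ⟨b, rfl⟩ <;> simp at hu hv
  | succ n ih =>
    obtain ⟨u, v, hu, hv, hadj, h1, h2, h3⟩ := h
    -- `k b` bounds the rise in the transfer from branch `b`; the root must have lost at least the
    -- sum of these.
    have key : ∃ k : Bool → ℤ, (C' [] : ℤ) + k false + k true ≤ C [] ∧ ∀ b σ,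
        edgeTransfer (surplus n (branch C' b) σ) ≤ edgeTransfer (surplus n (branch C b) σ) + k b := by
      rcases u with _ | ⟨c, u⟩
      · obtain ⟨b, rfl⟩ : ∃ b, v = [b] := by
          rcases hadj with ⟨b, hb⟩ | ⟨b, hb⟩
          · exact ⟨b, hb⟩
          · simp at hb
        refine ⟨fun c => if c = b then 2 else 0, ?_, fun c σ => ?_⟩
        · cases b <;> simp <;> omega
        · by_cases hc : c = b
          · subst hc
            rw [surplus_eq_of_branch_eq (C := branch C c) (C' := branch C' c) (k := 1)]
            · simp only [if_true]; unfold edgeTransfer; split_ifs <;> omega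
            · funext d l; exact h3 (c :: d :: l) (by simp) (by simp)
            · have : branch C' c [] = branch C c [] + 1 := h2
              omega
          · have : branch C' c = branch C c := by
              funext l; exact h3 (c :: l) (by simp) (by simp [hc])
            simp [this, hc]
      · rcases v with _ | ⟨d, v⟩
        · obtain rfl : u = [] := by
            rcases hadj with ⟨b, hb⟩ | ⟨b, hb⟩ <;> simp at hb
            exact hb.2
          refine ⟨fun b => if b = c then -1 else 0, ?_, fun b σ => ?_⟩
          · cases c <;> simp <;> omega
          · by_cases hc : b = c
            · subst hc
              rw [surplus_eq_of_branch_eq (C := branch C b) (C' := branch C' b) (k := -2)]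
              · simp only [if_true]; unfold edgeTransfer; split_ifs <;> omega
              · funext d l; exact h3 (b :: d :: l) (by simp) (by simp)
              · have : branch C b [] = branch C' b [] + 2 := h1
                omega
            · have : branch C' b = branch C b := by
                funext l; exact h3 (b :: l) (by simp [hc]) (by simp)
              simp [this, hc]
        · obtain rfl : c = d := by
            rcases hadj with ⟨b, hb⟩ | ⟨b, hb⟩ <;> simp at hb
            · exact hb.1.symm
            · exact hb.1
          refine ⟨fun _ => 0, ?_, fun b σ => ?_⟩
          · rw [h3 [] (by simp) (by simp)]; simp
          · by_cases hc : b = c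
            · subst hc
              rw [add_zero]
              refine edgeTransfer_mono (ih ⟨u, v, by simpa using hu, by simpa using hv, ?_, h1, h2,
                fun w hwu hwv => h3 (b :: w) (by simpa using hwu) (by simpa using hwv)⟩ σ)
              rcases hadj with ⟨e, he⟩ | ⟨e, he⟩
              · exact Or.inl ⟨e, by simpa using he⟩
              · exact Or.inr ⟨e, by simpa using he⟩
            · have : branch C' b = branch C b := by
                funext l; exact h3 (b :: l) (by simp [hc]) (by simp [hc])
              simp [this]
    obtain ⟨k, hk, hs⟩ := key
    exact combineSurplus_mono _ _ (hs false) (hs true) hk σ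

theorem TreeReach.surplus_le {n : ℕ} {C C' : List Bool → ℕ} (h : TreeReach n C C')
    (σ : RootState) : surplus n C' σ ≤ surplus n C σ := by
  induction h with
  | refl => exact le_rfl
  | tail _ hm ih => exact (hm.surplus_le σ).trans ih

/-! ### Dominating configurations -/

/-- Domination of a tree with root `r` in terms of its two branches. -/
def CombineCovered (r : ℕ) (x y : RootState → Prop) : RootState → Prop
  | pebbled => 0 < r ∧ x free ∧ y free
  | dominated => (0 < r ∧ x free ∧ y free) ∨ (x pebbled ∧ y dominated) ∨ (x dominated ∧ y pebbled)
  | free => ((0 < r ∧ x free ∧ y free) ∨ (x pebbled ∧ y dominated) ∨ (x dominated ∧ y pebbled)) ∨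
      (x dominated ∧ y dominated)

/-- The pebbled vertices dominate the tree of height `n` except possibly its root, which is in the
given state. -/
def Covered : ℕ → (List Bool → ℕ) → RootState → Prop
  | 0, C, pebbled => 0 < C []
  | 0, C, dominated => 0 < C []
  | 0, _, free => True
  | n + 1, C, σ => CombineCovered (C []) (Covered n (branch C false)) (Covered n (branch C true)) σ

theorem Covered.surplus_nonneg {n : ℕ} {C : List Bool → ℕ} {σ : RootState} (h : Covered n C σ) :
    0 ≤ surplus n C σ := by
  induction n generalizing C σ with
  | zero => cases σ <;> simp only [Covered, surplus] at * <;> omega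
  | succ n ih =>
    have hx : ∀ b τ, Covered n (branch C b) τ → 0 ≤ edgeTransfer (surplus n (branch C b) τ) :=
      fun b τ h => edgeTransfer_nonneg (ih h)
    have h0 : (0 : ℤ) ≤ C [] := by positivity
    cases σ
    · obtain ⟨h1, h2, h3⟩ := h
      have := hx _ _ h2; have := hx _ _ h3
      simp only [surplus, combineSurplus]; omega
    · rcases h with ⟨h1, h2, h3⟩ | ⟨h2, h3⟩ | ⟨h2, h3⟩ <;>
      · have := hx _ _ h2; have := hx _ _ h3
        simp only [surplus, combineSurplus]; omega
    · rcases h with (⟨h1, h2, h3⟩ | ⟨h2, h3⟩ | ⟨h2, h3⟩) | ⟨h2, h3⟩ <;>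
      · have := hx _ _ h2; have := hx _ _ h3
        simp only [surplus, combineSurplus]; omega

/-- The vertex `l` of the tree of height `n` carries a pebble or has a neighbour that does. -/
def DominatedAt (n : ℕ) (C : List Bool → ℕ) (l : List Bool) : Prop :=
  0 < C l ∨ (∃ b, l.length < n ∧ 0 < C (l ++ [b])) ∨ ∃ l' b, l = l' ++ [b] ∧ 0 < C l'

theorem dominatedAt_cons_cons (n : ℕ) (C : List Bool → ℕ) (b c : Bool) (l : List Bool) :
    DominatedAt (n + 1) C (b :: c :: l) ↔ DominatedAt n (branch C b) (c :: l) := by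
  unfold DominatedAt
  refine or_congr Iff.rfl (or_congr (by simp [branch]) ⟨?_, ?_⟩)
  · rintro ⟨_ | ⟨d, l'⟩, e, h, h'⟩
    · simp at h
    · simp only [List.cons_append, List.cons.injEq] at h
      obtain ⟨rfl, h⟩ := h
      exact ⟨l', e, h, h'⟩
  · rintro ⟨l', e, h, h'⟩
    exact ⟨b :: l', e, by simp [h], h'⟩

theorem dominatedAt_singleton (n : ℕ) (C : List Bool → ℕ) (b : Bool) :
    DominatedAt (n + 1) C [b] ↔ 0 < C [] ∨ DominatedAt n (branch C b) [] := by
  unfold DominatedAt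
  constructor
  · rintro (h | ⟨c, h, h'⟩ | ⟨l', c, h, h'⟩)
    · exact Or.inr (Or.inl h)
    · exact Or.inr (Or.inr (Or.inl ⟨c, by simpa using h, h'⟩))
    · obtain rfl : l' = [] := by
        cases l' with
        | nil => rfl
        | cons d l' => simp at h
      exact Or.inl h'
  · rintro (h | h | ⟨c, h, h'⟩ | ⟨l', c, h, h'⟩)
    · exact Or.inr (Or.inr ⟨[], b, rfl, h⟩)
    · exact Or.inl h
    · exact Or.inr (Or.inl ⟨c, by simpa using h, h'⟩)
    · simp at h

theorem dominatedAt_nil (n : ℕ) (C : List Bool → ℕ) :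
    DominatedAt (n + 1) C [] ↔ 0 < C [] ∨ 0 < C [false] ∨ 0 < C [true] := by
  simp [DominatedAt]

/-- A vertex of depth at least 2 sees only its own branch, and a child of the root sees the root as
well. Hence a pebbled root frees both branches, and otherwise each child must be dominated within
its branch. -/
theorem covered_iff (n : ℕ) (C : List Bool → ℕ) :
    (Covered n C free ↔ ∀ l, l ≠ [] → l.length ≤ n → DominatedAt n C l) ∧
    (Covered n C dominated ↔ DominatedAt n C [] ∧ Covered n C free) ∧
    (Covered n C pebbled ↔ 0 < C [] ∧ Covered n C free) := by
  induction n generalizing C with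
  | zero =>
    refine ⟨?_, by simp [Covered, DominatedAt], by simp [Covered]⟩
    simp only [Covered, true_iff]
    intro l h h'
    exact absurd (List.length_eq_zero_iff.mp (Nat.le_zero.mp h')) h
  | succ n ih =>
    obtain ⟨f1, f2, f3⟩ := ih (branch C false)
    obtain ⟨t1, t2, t3⟩ := ih (branch C true)
    have key : (∀ l, l ≠ [] → l.length ≤ n + 1 → DominatedAt (n + 1) C l) ↔
        ∀ b, (0 < C [] ∨ DominatedAt n (branch C b) []) ∧ Covered n (branch C b) free := by
      constructor
      · intro h b
        refine ⟨(dominatedAt_singleton n C b).mp (h [b] (by simp) (by simp)), (ih _).1.mpr ?_⟩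
        rintro (_ | ⟨c, l⟩) hl hn
        · exact absurd rfl hl
        · exact (dominatedAt_cons_cons n C b c l).mp (h _ (by simp) (by simpa using hn))
      · rintro h (_ | ⟨b, _ | ⟨c, l⟩⟩) hl hn
        · exact absurd rfl hl
        · exact (dominatedAt_singleton n C b).mpr (h b).1
        · exact (dominatedAt_cons_cons n C b c l).mpr
            ((ih _).1.mp (h b).2 _ (by simp) (by simpa using hn))
    have hnil : ∀ b, 0 < C [b] → DominatedAt n (branch C b) [] := fun b h => Or.inl h
    have hF : 0 < branch C false [] ↔ 0 < C [false] := Iff.rfl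
    have hT : 0 < branch C true [] ↔ 0 < C [true] := Iff.rfl
    have hf := hnil false
    have ht := hnil true
    rw [key, dominatedAt_nil]
    simp only [Covered, CombineCovered, Bool.forall_bool, f2, f3, t2, t3, hF, hT]
    clear key f1 f2 f3 t1 t2 t3 hnil ih
    refine ⟨?_, ?_, ?_⟩ <;> tauto

/-- With `k` extra pebbles on the root covering any deficit, the tree of height `n` can be
covered in the state `σ` so that the surplus is still on the root. -/
def SurplusRealized (n : ℕ) (C : List Bool → ℕ) (σ : RootState) : Prop :=
  ∀ k : ℕ, 0 ≤ surplus n C σ + k → ∃ C', TreeReach n (setRoot C (C [] + k)) C' ∧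
    surplus n C σ + k ≤ C' [] ∧
    ∀ j : ℕ, (j : ℤ) ≤ surplus n C σ + k → Covered n (setRoot C' (C' [] - j)) σ

/-- A branch with a surplus is solved first and then sends pairs up; one with a deficit first
receives exactly the missing pebbles and is then solved. -/
theorem SurplusRealized.exists_branch {n : ℕ} {D : List Bool → ℕ} {σ : RootState}
    (h : SurplusRealized n D σ) : ∃ D', Covered n D' σ ∧
      ∀ (r r' : ℕ) (F : Bool → List Bool → ℕ) (b : Bool), F b = D →
        (r' : ℤ) = r + edgeTransfer (surplus n D σ) →
        TreeReach (n + 1) (graft r F) (graft r' (Function.update F b D')) := by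
  rcases le_or_gt 0 (surplus n D σ) with hx | hx
  · obtain ⟨C', hreach, hle, hcov⟩ := h 0 (by simpa using hx)
    obtain ⟨q, hq⟩ := Int.eq_ofNat_of_zero_le (edgeTransfer_nonneg hx)
    have hq' : edgeTransfer (surplus n D σ) = surplus n D σ / 2 := if_pos hx
    refine ⟨setRoot C' (C' [] - 2 * q), hcov _ (by push_cast; omega), ?_⟩
    rintro r r' F b rfl hr
    obtain rfl : r' = r + q := by omega
    have h1 := hreach.graft_update r F b
    rw [add_zero, setRoot_self, Function.update_eq_self] at h1
    have h2 := treeReach_push_up n r F b C' (C' [] - 2 * q) q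
    rw [Nat.sub_add_cancel (by omega), setRoot_self] at h2
    exact h1.trans h2
  · obtain ⟨k, hk⟩ := Int.eq_ofNat_of_zero_le (neg_nonneg.mpr hx.le)
    obtain ⟨C', hreach, hle, hcov⟩ := h k (by omega)
    have hq' : edgeTransfer (surplus n D σ) = 2 * surplus n D σ := if_neg (by omega)
    refine ⟨C', by simpa [setRoot_self] using hcov 0 (by omega), ?_⟩
    rintro r r' F b rfl hr
    obtain rfl : r = r' + 2 * k := by omega
    have h1 := treeReach_push_down n r' F b (F b) (F b []) k
    rw [setRoot_self, Function.update_eq_self] at h1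
    exact h1.trans (hreach.graft_update r' F b)

theorem SurplusRealized.exists_graft {n : ℕ} {F : Bool → List Bool → ℕ} {σ τ : RootState}
    (hσ : SurplusRealized n (F false) σ) (hτ : SurplusRealized n (F true) τ) (r r' : ℕ)
    (hr : (r' : ℤ) = r + edgeTransfer (surplus n (F false) σ)
      + edgeTransfer (surplus n (F true) τ)) :
    ∃ F', TreeReach (n + 1) (graft r F) (graft r' F') ∧ Covered n (F' false) σ ∧
      Covered n (F' true) τ := by
  obtain ⟨D, hD, hDr⟩ := hσ.exists_branch
  obtain ⟨E, hE, hEr⟩ := hτ.exists_branch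
  -- A branch that gives is treated before one that takes, so the number of pebbles on the root
  -- never becomes negative.
  rcases le_or_gt 0 (edgeTransfer (surplus n (F false) σ)) with h | h
  · obtain ⟨s, hs⟩ := Int.eq_ofNat_of_zero_le (add_nonneg (Int.natCast_nonneg r) h)
    refine ⟨Function.update (Function.update F false D) true E,
      (hDr r s F false rfl hs.symm).trans
        (hEr s r' _ true (by simp) (by omega)), by simpa using hD, by simpa using hE⟩
  · obtain ⟨s, hs⟩ := Int.eq_ofNat_of_zero_le
      (show 0 ≤ (r : ℤ) + edgeTransfer (surplus n (F true) τ) by omega)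
    refine ⟨Function.update (Function.update F true E) false D,
      (hEr r s F true rfl hs.symm).trans
        (hDr s r' _ false (by simp) (by omega)), by simpa using hD, by simpa using hE⟩

theorem surplusRealized (n : ℕ) (C : List Bool → ℕ) (σ : RootState) : SurplusRealized n C σ := by
  induction n generalizing C σ with
  | zero =>
    intro k h
    refine ⟨_, Relation.ReflTransGen.refl, ?_, ?_⟩
    · cases σ <;> simp [surplus]
    · intro j hj
      cases σ <;> simp [surplus, Covered] at * <;> omega
  | succ n ih =>
    intro k h
    -- Each term of the maximum defining the surplus is one strategy: states for the two children,
    -- and the number `d` of pebbles that must stay on the root.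
    have key : ∀ (τ₁ τ₂ : RootState) (d : ℕ),
        surplus (n + 1) C σ = (C [] : ℤ) - d + edgeTransfer (surplus n (branch C false) τ₁)
          + edgeTransfer (surplus n (branch C true) τ₂) →
        (∀ (r : ℕ) (x y : RootState → Prop), x τ₁ → y τ₂ → d ≤ r → CombineCovered r x y σ) →
        ∃ C', TreeReach (n + 1) (setRoot C (C [] + k)) C' ∧ surplus (n + 1) C σ + k ≤ C' [] ∧
          ∀ j : ℕ, (j : ℤ) ≤ surplus (n + 1) C σ + k →
            Covered (n + 1) (setRoot C' (C' [] - j)) σ := by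
      intro τ₁ τ₂ d hs hc
      obtain ⟨r', hr'⟩ := Int.eq_ofNat_of_zero_le
        (show 0 ≤ surplus (n + 1) C σ + k + d by omega)
      obtain ⟨F', hF, h1, h2⟩ := (ih (branch C false) τ₁).exists_graft (ih (branch C true) τ₂)
        (C [] + k) r' (by push_cast; omega)
      refine ⟨graft r' F', hF, by simp only [graft_nil]; omega, fun j hj => ?_⟩
      exact hc _ _ _ h1 h2 (by simp only [graft_nil]; omega)
    cases σ
    · exact key free free 1 (by simp [surplus, combineSurplus])
        fun r x y hx hy hr => ⟨hr, hx, hy⟩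
    · have hm : surplus (n + 1) C dominated = max _ (max _ _) := rfl
      rcases max_choice ((C [] : ℤ) - 1 + edgeTransfer (surplus n (branch C false) free) +
        edgeTransfer (surplus n (branch C true) free))
        (max (C [] + edgeTransfer (surplus n (branch C false) pebbled) +
            edgeTransfer (surplus n (branch C true) dominated))
          (C [] + edgeTransfer (surplus n (branch C false) dominated) +
            edgeTransfer (surplus n (branch C true) pebbled))) with h1 | h1
      · exact key free free 1 (hm.trans h1) fun r x y hx hy hr => Or.inl ⟨hr, hx, hy⟩
      · rw [h1] at hm
        rcases max_choice ((C [] : ℤ) + edgeTransfer (surplus n (branch C false) pebbled) +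
            edgeTransfer (surplus n (branch C true) dominated))
          (C [] + edgeTransfer (surplus n (branch C false) dominated) +
            edgeTransfer (surplus n (branch C true) pebbled)) with h2 | h2
        · exact key pebbled dominated 0 (by rw [hm, h2]; simp)
            fun r x y hx hy hr => Or.inr (Or.inl ⟨hx, hy⟩)
        · exact key dominated pebbled 0 (by rw [hm, h2]; simp)
            fun r x y hx hy hr => Or.inr (Or.inr ⟨hx, hy⟩)
    · have hm : surplus (n + 1) C free = max (max _ (max _ _)) _ := rfl
      have hcases : surplus (n + 1) C free = (C [] : ℤ) - (1 : ℕ) +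
            edgeTransfer (surplus n (branch C false) free) +
            edgeTransfer (surplus n (branch C true) free) ∨
          surplus (n + 1) C free = (C [] : ℤ) - (0 : ℕ) +
            edgeTransfer (surplus n (branch C false) pebbled) +
            edgeTransfer (surplus n (branch C true) dominated) ∨
          surplus (n + 1) C free = (C [] : ℤ) - (0 : ℕ) +
            edgeTransfer (surplus n (branch C false) dominated) +
            edgeTransfer (surplus n (branch C true) pebbled) ∨
          surplus (n + 1) C free = (C [] : ℤ) - (0 : ℕ) +
            edgeTransfer (surplus n (branch C false) dominated) +
            edgeTransfer (surplus n (branch C true) dominated) := by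
        simp only [surplus, combineSurplus]; omega
      rcases hcases with h1 | h1 | h1 | h1
      · exact key free free 1 h1 fun r x y hx hy hr => Or.inl (Or.inl ⟨hr, hx, hy⟩)
      · exact key pebbled dominated 0 h1 fun r x y hx hy hr => Or.inl (Or.inr (Or.inl ⟨hx, hy⟩))
      · exact key dominated pebbled 0 h1 fun r x y hx hy hr => Or.inl (Or.inr (Or.inr ⟨hx, hy⟩))
      · exact key dominated dominated 0 h1 fun r x y hx hy hr => Or.inr ⟨hx, hy⟩

/-! ### Solvability on `B_n` in terms of the surplus -/

/-- The extension by zero of a configuration on `B_n`. -/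
def extendConfig {n : ℕ} (C : BinaryTreeVertex n → ℕ) : List Bool → ℕ :=
  fun l => if h : l.length ≤ n then C ⟨l, h⟩ else 0

@[simp] theorem extendConfig_coe {n : ℕ} (C : BinaryTreeVertex n → ℕ) (v : BinaryTreeVertex n) :
    extendConfig C v.1 = C v := by
  simp [extendConfig, v.2]

theorem TreeMove.pebblingMove {n : ℕ} {D D' : List Bool → ℕ} (h : TreeMove n D D') :
    PebblingMove (completeBinaryTree n) (fun v => D v.1) (fun v => D' v.1) := by
  obtain ⟨u, v, hu, hv, hadj, h1, h2, h3⟩ := h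
  exact ⟨⟨u, hu⟩, ⟨v, hv⟩, hadj, h1, h2, fun w hwu hwv =>
    h3 w.1 (fun h => hwu (Subtype.ext h)) (fun h => hwv (Subtype.ext h))⟩

theorem PebblingMove.treeMove {n : ℕ} {C C' : BinaryTreeVertex n → ℕ}
    (h : PebblingMove (completeBinaryTree n) C C') :
    TreeMove n (extendConfig C) (extendConfig C') := by
  obtain ⟨u, v, hadj, h1, h2, h3⟩ := h
  refine ⟨u.1, v.1, u.2, v.2, hadj, by simpa using h1, by simpa using h2, fun w hwu hwv => ?_⟩
  by_cases hw : w.length ≤ n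
  · simpa [extendConfig, hw] using h3 ⟨w, hw⟩ (fun h => hwu (congrArg Subtype.val h))
      (fun h => hwv (congrArg Subtype.val h))
  · simp [extendConfig, hw]

theorem isDominatingSet_iff_covered (n : ℕ) (D : List Bool → ℕ) :
    IsDominatingSet (completeBinaryTree n) {v : BinaryTreeVertex n | 0 < D v.1} ↔
      Covered n D dominated := by
  obtain ⟨h1, h2, -⟩ := covered_iff n D
  have hat : ∀ v : BinaryTreeVertex n,
      (v ∈ {v : BinaryTreeVertex n | 0 < D v.1} ∨
        ∃ u ∈ {v : BinaryTreeVertex n | 0 < D v.1}, (completeBinaryTree n).Adj v u) ↔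
      DominatedAt n D v.1 := by
    rintro ⟨l, hl⟩
    refine or_congr Iff.rfl ⟨?_, ?_⟩
    · rintro ⟨⟨u, hu⟩, hpos, ⟨b, hb⟩ | ⟨b, hb⟩⟩
      · dsimp only at hb
        subst hb
        exact Or.inl ⟨b, by simpa using hu, hpos⟩
      · exact Or.inr ⟨u, b, hb, hpos⟩
    · rintro (⟨b, hb, hpos⟩ | ⟨l', b, rfl, hpos⟩)
      · exact ⟨⟨l ++ [b], by simpa using hb⟩, hpos, Or.inl ⟨b, rfl⟩⟩
      · exact ⟨⟨l', (by simp at hl; omega)⟩, hpos, Or.inr ⟨b, rfl⟩⟩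
  rw [h2, h1]
  constructor
  · intro h
    exact ⟨(hat ⟨[], by simp⟩).mp (h _), fun l _ hl => (hat ⟨l, hl⟩).mp (h _)⟩
  · rintro ⟨h, h'⟩ v
    rw [hat]
    by_cases hv : v.1 = []
    · rw [hv]; exact h
    · exact h' _ hv v.2

theorem surplus_congr {n : ℕ} {C D : List Bool → ℕ} (h : ∀ l, l.length ≤ n → C l = D l)
    (σ : RootState) : surplus n C σ = surplus n D σ := by
  induction n generalizing C D σ with
  | zero => cases σ <;> simp [surplus, h [] (by simp)]
  | succ n ih =>
    have hb : ∀ b, surplus n (branch C b) = surplus n (branch D b) := fun b =>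
      funext fun τ => ih (fun l hl => h (b :: l) (by simpa using hl)) τ
    simp only [surplus, hb, h [] (by simp)]

theorem hasDominationCoverSolution_iff (n : ℕ) (D : List Bool → ℕ) :
    HasDominationCoverSolution (completeBinaryTree n) (fun v => D v.1) ↔
      0 ≤ surplus n D dominated := by
  constructor
  · rintro ⟨C', hreach, hdom⟩
    have h1 : TreeReach n (extendConfig fun v : BinaryTreeVertex n => D v.1) (extendConfig C') :=
      Relation.ReflTransGen.lift extendConfig (fun _ _ hm => PebblingMove.treeMove hm) _ _ hreach
    have h2 : Covered n (extendConfig C') dominated := by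
      rw [← isDominatingSet_iff_covered]
      simpa using hdom
    rw [← surplus_congr (C := extendConfig fun v : BinaryTreeVertex n => D v.1)
      (fun l hl => by simp [extendConfig, hl])]
    exact h2.surplus_nonneg.trans (h1.surplus_le _)
  · intro h
    obtain ⟨C', hreach, -, hcov⟩ := surplusRealized n D dominated 0 (by simpa using h)
    rw [add_zero, setRoot_self] at hreach
    refine ⟨fun v => C' v.1, Relation.ReflTransGen.lift (fun (E : List Bool → ℕ)
      (v : BinaryTreeVertex n) => E v.1) (fun _ _ hm => TreeMove.pebblingMove hm) _ _ hreach, ?_⟩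
    rw [isDominatingSet_iff_covered]
    simpa [setRoot_self] using hcov 0 (by simpa using h)

/-! ### Lower bounds for the surplus -/

/-- `1` if the root of the tree of height `m` is in the canonical dominating set, which consists of
the vertices at height congruent to `1` modulo `3`. -/
def canonicalRoot (m : ℕ) : ℕ := if m % 3 = 1 then 1 else 0

/-- The number of pebbles on the root needed to cover the canonical dominating set of the tree of
height `m`. -/
def rootCost : ℕ → ℕ
  | 0 => 0
  | m + 1 => 4 * rootCost m + canonicalRoot (m + 1)

/-- One less than the number of pebbles on a leaf needed to cover the canonical dominating set of
the tree of height `m ≥ 1`. -/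
def leafThreshold : ℕ → ℕ
  | 0 => 0
  | 1 => 1
  | m + 2 => leafThreshold (m + 1) + 2 ^ (m + 2) * (2 * rootCost (m + 1) + canonicalRoot (m + 2))

theorem leafThreshold_succ {m : ℕ} (hm : 1 ≤ m) : leafThreshold (m + 1) =
    leafThreshold m + 2 ^ (m + 1) * (2 * rootCost m + canonicalRoot (m + 1)) := by
  obtain ⟨m, rfl⟩ := Nat.exists_eq_add_of_le' hm; rfl

theorem one_le_rootCost (m : ℕ) : 1 ≤ rootCost (m + 1) := by
  induction m with
  | zero => decide
  | succ m ih => rw [rootCost]; omega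

theorem leafThreshold_le {m : ℕ} (hm : 1 ≤ m) : leafThreshold m ≤ 2 ^ (m + 1) * rootCost m := by
  induction m, hm using Nat.le_induction with
  | base => decide
  | succ m hm ih =>
    rw [leafThreshold_succ hm, rootCost, pow_succ 2 (m + 1)]
    nlinarith [Nat.zero_le (2 ^ (m + 1) * rootCost m),
      Nat.zero_le (2 ^ (m + 1) * canonicalRoot (m + 1))]

/-- The transfer along an edge is subadditive once the deficit `Z` of the empty branch is
subtracted. -/
theorem edgeTransfer_add_le {Z x y : ℤ} (hZ : 1 ≤ Z) (hx : -Z ≤ x) (hy : -Z ≤ y) :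
    edgeTransfer (x + y + Z) - 2 * Z ≤ edgeTransfer x + edgeTransfer y := by
  unfold edgeTransfer; split_ifs <;> omega

/-- The surplus in the state prescribed by the canonical dominating set. -/
def canonicalSurplus (m : ℕ) (C : List Bool → ℕ) : ℤ :=
  if m % 3 = 1 then surplus m C pebbled
  else if m % 3 = 2 then min (surplus m C dominated) (surplus m C pebbled + 1)
  else surplus m C free

theorem canonicalSurplus_succ (m : ℕ) (C : List Bool → ℕ) :
    (C [] : ℤ) - canonicalRoot (m + 1) + edgeTransfer (canonicalSurplus m (branch C false))
      + edgeTransfer (canonicalSurplus m (branch C true)) ≤ canonicalSurplus (m + 1) C := by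
  have hfree : ∀ D, surplus m D pebbled ≤ surplus m D free := fun D => by
    cases m <;> simp [surplus, combineSurplus]
  have hpd : ∀ D, surplus m D pebbled ≤ surplus m D dominated := fun D => by
    cases m <;> simp [surplus, combineSurplus]
  rcases (by omega : m % 3 = 0 ∨ m % 3 = 1 ∨ m % 3 = 2) with h | h | h
  · have h' : (m + 1) % 3 = 1 := by omega
    simp only [canonicalSurplus, canonicalRoot, h, h', surplus, combineSurplus]
    norm_num
  · have h' : (m + 1) % 3 = 2 := by omega
    have h1 := edgeTransfer_mono (hfree (branch C false))
    have h2 := edgeTransfer_mono (hfree (branch C true))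
    have h3 := edgeTransfer_mono (hpd (branch C true))
    simp only [canonicalSurplus, canonicalRoot, h, h', surplus, combineSurplus]
    norm_num
    omega
  · have h' : (m + 1) % 3 = 0 := by omega
    simp only [canonicalSurplus, canonicalRoot, h, h', surplus, combineSurplus]
    norm_num
    have h1 : ∀ D : List Bool → ℕ, edgeTransfer (min (surplus m D dominated)
        (surplus m D pebbled + 1)) ≤ edgeTransfer (surplus m D dominated) :=
      fun D => edgeTransfer_mono (min_le_left _ _)
    have h2 := h1 (branch C false)
    have h3 := h1 (branch C true)
    omega

/-- `ψ s` is a lower bound for the gain in canonical surplus, over the empty tree of height `m`,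
from `2 ^ (m - 1) + s` pebbles. -/
structure IsGainBound (m : ℕ) (ψ : ℕ → ℤ) : Prop where
  mono : Monotone ψ
  zero : ψ 0 = 0
  add_le : ∀ i j, ψ (i + j) ≤ ψ i + ψ j
  large : ∀ x : ℕ, (rootCost m : ℤ) + x ≤ ψ (leafThreshold m + 2 ^ m * x)
  le_surplus : ∀ C, -(rootCost m : ℤ) + ψ (pebbleCount m C - 2 ^ (m - 1)) ≤ canonicalSurplus m C

theorem surplus_one_bounds (C : List Bool → ℕ) :
    (((pebbleCount 1 C : ℤ) - 1) / 2 ≤ surplus 1 C pebbled + 1 ∧ -1 ≤ surplus 1 C pebbled) ∧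
    (pebbleCount 1 C : ℤ) / 2 ≤ surplus 1 C dominated + 1 ∧
    (pebbleCount 1 C : ℤ) / 2 ≤ surplus 1 C free + 1 := by
  simp only [pebbleCount, surplus, combineSurplus, edgeTransfer, Nat.cast_add]
  split_ifs <;> omega

/-- The induction cannot start at height 1: two pebbles on different leaves gain nothing in the
state `pebbled`, whereas `large` would demand a gain of 1. At height 2 such a branch is used in the
state `dominated` instead. -/
theorem isGainBound_two : IsGainBound 2 (fun s => min (s : ℤ) ((s + 7) / 4)) where
  mono := by intro i j h; dsimp only; omega
  zero := by norm_num
  add_le i j := by push_cast; omega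
  large x := by
    have h1 : rootCost 2 = 4 := rfl
    have h2 : leafThreshold 2 = 9 := rfl
    rw [h1, h2]; push_cast; omega
  le_surplus C := by
    have h1 : rootCost 2 = 4 := rfl
    obtain ⟨⟨a1, a2⟩, a3, a4⟩ := surplus_one_bounds (branch C false)
    obtain ⟨⟨b1, b2⟩, b3, b4⟩ := surplus_one_bounds (branch C true)
    have hB : ∀ (x : ℕ) (q : ℤ), (x : ℤ) / 2 ≤ q + 1 →
        -2 ≤ edgeTransfer q ∧ (2 ≤ x → ((x : ℤ) - 2) / 4 ≤ edgeTransfer q) := by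
      intro x q h
      unfold edgeTransfer; split_ifs <;> omega
    have hA : ∀ (x : ℕ) (q : ℤ), ((x : ℤ) - 1) / 2 ≤ q + 1 → -1 ≤ q →
        -2 ≤ edgeTransfer q ∧ (3 ≤ x → ((x : ℤ) - 3) / 4 ≤ edgeTransfer q) := by
      intro x q h h'
      unfold edgeTransfer; split_ifs <;> omega
    have hp : surplus 2 C pebbled = (C [] : ℤ) - 1 + edgeTransfer (surplus 1 (branch C false) free)
      + edgeTransfer (surplus 1 (branch C true) free) := rfl
    have hd1 : surplus 2 C pebbled ≤ surplus 2 C dominated := le_max_left _ _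
    have hd2 : (C [] : ℤ) + edgeTransfer (surplus 1 (branch C false) pebbled) +
        edgeTransfer (surplus 1 (branch C true) dominated) ≤ surplus 2 C dominated :=
      (le_max_left _ _).trans (le_max_right _ _)
    have hd3 : (C [] : ℤ) + edgeTransfer (surplus 1 (branch C false) dominated) +
        edgeTransfer (surplus 1 (branch C true) pebbled) ≤ surplus 2 C dominated :=
      (le_max_right _ _).trans (le_max_right _ _)
    have hc : pebbleCount 2 C = C [] + pebbleCount 1 (branch C false) +
      pebbleCount 1 (branch C true) := rfl
    have hcan : canonicalSurplus 2 C = min (surplus 2 C dominated) (surplus 2 C pebbled + 1) := rfl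
    obtain ⟨u1, u1'⟩ := hA _ _ a1 a2
    obtain ⟨u2, u2'⟩ := hB _ _ a3
    obtain ⟨u3, u3'⟩ := hB _ _ a4
    obtain ⟨v1, v1'⟩ := hA _ _ b1 b2
    obtain ⟨v2, v2'⟩ := hB _ _ b3
    obtain ⟨v3, v3'⟩ := hB _ _ b4
    clear a1 a2 a3 a4 b1 b2 b3 b4 hA hB
    rw [hcan, h1, hc]
    generalize pebbleCount 1 (branch C false) = x, pebbleCount 1 (branch C true) = y,
      surplus 2 C dominated = D, surplus 2 C pebbled = P at *
    norm_num only
    refine le_min ?_ ?_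
    · rcases (by omega : x ≤ 1 ∨ x = 2 ∨ 3 ≤ x) with hx | hx | hx <;>
      rcases (by omega : y ≤ 1 ∨ y = 2 ∨ 3 ≤ y) with hy | hy | hy <;> omega
    · rcases le_or_gt x 1 with hx | hx <;> rcases le_or_gt y 1 with hy | hy <;> omega

/-- The wasted pebbles of the two branches add up to `2 ^ m`, and by `edgeTransfer_add_le` the
remaining gain is least when one branch has it all. What is left to choose is how many pebbles lie
on the root, so the new bound is a minimum over that number. -/
theorem IsGainBound.succ {m : ℕ} (hm : 2 ≤ m) {ψ : ℕ → ℤ} (h : IsGainBound m ψ) :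
    ∃ ψ', IsGainBound (m + 1) ψ' := by
  have hZ : (1 : ℤ) ≤ rootCost m := by
    obtain ⟨k, rfl⟩ := Nat.exists_eq_add_of_le' (show 1 ≤ m by omega)
    exact_mod_cast one_le_rootCost k
  set Z : ℤ := (rootCost m : ℤ) with hZdef
  have hψ0 : ∀ s, 0 ≤ ψ s := fun s => h.zero ▸ h.mono (Nat.zero_le s)
  -- `t` pebbles lie on the root and `s - t` in one branch; the `2 * Z` offsets the transfer `-2 *
  -- Z` of that branch when it gains nothing.
  let T : ℕ → ℕ → ℤ := fun s t => t + (2 * Z + edgeTransfer (ψ (s - t) - Z))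
  let ψ' : ℕ → ℤ := fun s => (Finset.range (s + 1)).inf' (by simp) (T s)
  have hle : ∀ s t, t ≤ s → ψ' s ≤ T s t := fun s t hts =>
    Finset.inf'_le _ (by simp; omega)
  have hex : ∀ s, ∃ t ≤ s, ψ' s = T s t := fun s => by
    obtain ⟨t, ht, h⟩ := Finset.exists_mem_eq_inf' (s := Finset.range (s + 1)) (by simp) (T s)
    exact ⟨t, by simp at ht; omega, h⟩
  have hE0 : ∀ s, 0 ≤ 2 * Z + edgeTransfer (ψ s - Z) := fun s => by
    have := hψ0 s
    unfold edgeTransfer; split_ifs <;> omega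
  have hsub : ∀ i j, 2 * Z + edgeTransfer (ψ (i + j) - Z) ≤
      (2 * Z + edgeTransfer (ψ i - Z)) + (2 * Z + edgeTransfer (ψ j - Z)) := fun i j => by
    have h1 := edgeTransfer_add_le hZ (x := ψ i - Z) (y := ψ j - Z) (by linarith [hψ0 i])
      (by linarith [hψ0 j])
    have h2 := edgeTransfer_mono (x := ψ (i + j) - Z) (y := ψ i - Z + (ψ j - Z) + Z)
      (by linarith [h.add_le i j])
    linarith
  have hmono : Monotone ψ' := by
    intro i j hij
    obtain ⟨t, ht, h1⟩ := hex j
    rw [h1]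
    rcases le_total t i with hti | hti
    · refine (hle i t hti).trans ?_
      have := edgeTransfer_mono (x := ψ (i - t) - Z) (y := ψ (j - t) - Z)
        (by linarith [h.mono (show i - t ≤ j - t by omega)])
      simp only [T]; linarith
    · refine (hle i i le_rfl).trans ?_
      have := edgeTransfer_mono (x := ψ (i - i) - Z) (y := ψ (j - t) - Z)
        (by linarith [h.mono (show i - i ≤ j - t by omega)])
      simp only [T]; have : (i : ℤ) ≤ t := by exact_mod_cast hti
      linarith
  refine ⟨ψ', hmono, ?_, ?_, ?_, ?_⟩
  · obtain ⟨t, ht, h1⟩ := hex 0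
    obtain rfl : t = 0 := by omega
    rw [h1]
    simp only [T, Nat.sub_zero, h.zero, edgeTransfer]
    split_ifs <;> push_cast <;> omega
  · intro i j
    obtain ⟨s, hs, h1⟩ := hex i
    obtain ⟨t, ht, h2⟩ := hex j
    rw [h1, h2]
    refine (hle (i + j) (s + t) (by omega)).trans ?_
    have := hsub (i - s) (j - t)
    rw [show i - s + (j - t) = i + j - (s + t) by omega] at this
    simp only [T]; push_cast; linarith
  · intro x
    obtain ⟨t, ht, h1⟩ := hex (leafThreshold (m + 1) + 2 ^ (m + 1) * x)
    rw [h1, rootCost]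
    push_cast
    rw [← hZdef]
    set d := canonicalRoot (m + 1)
    have hL := leafThreshold_succ (show 1 ≤ m by omega)
    have hpow : 2 ≤ 2 ^ (m + 1) := by
      calc 2 = 2 ^ 1 := rfl
        _ ≤ 2 ^ (m + 1) := Nat.pow_le_pow_right (by norm_num) (by omega)
    -- Up to this value of `t`, the branch must send up the missing `e` pebbles. Beyond it, the
    -- branch need only be self-sufficient, and from `4 * rootCost m + d + x` on the root pays for
    -- everything.
    rcases le_total t (2 * rootCost m + d + x) with hq | hq
    · obtain ⟨e, he⟩ := Nat.exists_eq_add_of_le hq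
      have hsize : leafThreshold m + 2 ^ m * (2 * e) ≤
          leafThreshold (m + 1) + 2 ^ (m + 1) * x - t := by
        apply Nat.le_sub_of_add_le
        have : 2 ^ (m + 1) * (2 * rootCost m + d + x) = 2 ^ (m + 1) * (t + e) := by rw [he]
        rw [hL]
        have hp : 2 ^ (m + 1) = 2 * 2 ^ m := by ring
        nlinarith [Nat.mul_le_mul_right t hpow]
      have h2 := (h.large (2 * e)).trans (h.mono hsize)
      have h3 := edgeTransfer_mono (x := 2 * e) (y := ψ (leafThreshold (m + 1) +
        2 ^ (m + 1) * x - t) - Z) (by push_cast at h2; linarith)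
      have h4 : edgeTransfer (2 * (e : ℤ)) = e := by unfold edgeTransfer; split_ifs <;> omega
      simp only [T]
      omega
    · rcases le_total t (4 * rootCost m + d + x) with hq' | hq'
      · have hsize : leafThreshold m + 2 ^ m * 0 ≤
            leafThreshold (m + 1) + 2 ^ (m + 1) * x - t := by
          apply Nat.le_sub_of_add_le
          rw [hL]
          nlinarith [Nat.mul_le_mul_right (2 * rootCost m + d + x) hpow]
        have h2 := (h.large 0).trans (h.mono hsize)
        have h3 := edgeTransfer_nonneg (x := ψ (leafThreshold (m + 1) +
          2 ^ (m + 1) * x - t) - Z) (by push_cast at h2; linarith)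
        simp only [T]
        omega
      · have := hE0 (leafThreshold (m + 1) + 2 ^ (m + 1) * x - t)
        simp only [T]
        omega
  · intro C
    have hc := canonicalSurplus_succ m C
    have hL := edgeTransfer_mono (h.le_surplus (branch C false))
    have hR := edgeTransfer_mono (h.le_surplus (branch C true))
    rw [← hZdef, neg_add_eq_sub] at hL hR
    set i := pebbleCount m (branch C false) - 2 ^ (m - 1) with hi
    set j := pebbleCount m (branch C true) - 2 ^ (m - 1) with hj
    have h1 := hsub i j
    have h2 := hle (C [] + (i + j)) (C []) (by omega)
    have hp : 2 ^ m = 2 * 2 ^ (m - 1) := by rw [← pow_succ']; congr 1; omega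
    have h3 : ψ' (pebbleCount (m + 1) C - 2 ^ (m + 1 - 1)) ≤ ψ' (C [] + (i + j)) := by
      apply hmono
      rw [pebbleCount, Nat.add_sub_cancel, hp]
      omega
    simp only [T, Nat.add_sub_cancel_left] at h2
    rw [rootCost, Nat.add_sub_cancel] at *
    push_cast
    linarith

theorem exists_isGainBound {m : ℕ} (hm : 2 ≤ m) : ∃ ψ, IsGainBound m ψ := by
  induction m, hm using Nat.le_induction with
  | base => exact ⟨_, isGainBound_two⟩
  | succ m hm ih =>
    obtain ⟨ψ, h⟩ := ih
    exact h.succ hm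

/-- The least number of pebbles for which every configuration on the tree of height `n` has a
solution. -/
def solvableCount (n : ℕ) : ℕ :=
  leafThreshold n + 2 ^ (n - 1) + if n % 3 = 0 then 2 ^ (n - 1) else 0

/-- If 3 does not divide `n`, the canonical set dominates the root and `large` at `x = 0` suffices.
Otherwise the child with the larger canonical surplus is also pebbled. -/
theorem surplus_dominated_nonneg {n : ℕ} (hn : 2 ≤ n) {C : List Bool → ℕ}
    (hC : pebbleCount n C = solvableCount n) : 0 ≤ surplus n C dominated := by
  by_cases h0 : n % 3 = 0
  · obtain ⟨m, rfl⟩ := Nat.exists_eq_add_of_le' (show 1 ≤ n by omega)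
    obtain ⟨ψ, h⟩ := exists_isGainBound (show 2 ≤ m by omega)
    have hm : m % 3 = 2 := by omega
    have hp : 2 ^ m = 2 * 2 ^ (m - 1) := by rw [← pow_succ']; congr 1; omega
    have hd : canonicalRoot (m + 1) = 0 := by simp [canonicalRoot, h0]
    have hL := leafThreshold_succ (show 1 ≤ m by omega)
    have hLle := leafThreshold_le (show 1 ≤ m by omega)
    have hZ : 1 ≤ rootCost m := by
      obtain ⟨k, rfl⟩ := Nat.exists_eq_add_of_le' (show 1 ≤ m by omega)
      exact one_le_rootCost k
    have hψ0 : ∀ s, 0 ≤ ψ s := fun s => h.zero ▸ h.mono (Nat.zero_le s)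
    -- This is why `canonicalSurplus` takes a minimum at height 2 modulo 3: pebbling the child costs
    -- only one more.
    have hcan : ∀ b, canonicalSurplus m (branch C b) ≤ surplus m (branch C b) dominated ∧
        canonicalSurplus m (branch C b) - 1 ≤ surplus m (branch C b) pebbled := fun b => by
      simp only [canonicalSurplus, hm]; norm_num
    have key : ∀ b, canonicalSurplus m (branch C !b) ≤ canonicalSurplus m (branch C b) →
        0 ≤ (C [] : ℤ) + edgeTransfer (canonicalSurplus m (branch C b) - 1)
          + edgeTransfer (canonicalSurplus m (branch C !b)) := by
      intro b hb
      have hv := h.le_surplus (branch C b)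
      have hw := h.le_surplus (branch C !b)
      have hsum : pebbleCount (m + 1) C =
          C [] + pebbleCount m (branch C b) + pebbleCount m (branch C !b) := by
        cases b
        · rfl
        · simp only [pebbleCount, Bool.not_true]; ring
      rw [hC, solvableCount, if_pos h0, Nat.add_sub_cancel, hL, hd, pow_succ, hp] at hsum
      generalize canonicalSurplus m (branch C b) = v,
        canonicalSurplus m (branch C !b) = w at *
      set i := pebbleCount m (branch C b) - 2 ^ (m - 1) with hi
      set j := pebbleCount m (branch C !b) - 2 ^ (m - 1) with hj
      have hij : leafThreshold m + 2 ^ m * (4 * rootCost m + 1) ≤ C [] + (i + j) := by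
        have : 2 ^ m * (4 * rootCost m + 1) =
          2 * 2 ^ (m - 1) * 2 * (2 * rootCost m + 0) + 2 * 2 ^ (m - 1) := by rw [hp]; ring
        omega
      have hm1 : 1 ≤ 2 ^ m := Nat.one_le_two_pow
      have h0i := hψ0 i
      have h0j := hψ0 j
      -- If neither branch has a positive canonical surplus, both hold few pebbles, and the root has
      -- the `4 * rootCost m + 2` that cover the worst deficits. If `v > 0`, then `v - 1` is still
      -- nonnegative and subadditivity applies.
      rcases le_or_gt v 0 with hv0 | hv0
      · have hsmall : ∀ s, ψ s ≤ rootCost m → s < leafThreshold m + 2 ^ m * 1 := by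
          intro s hs
          by_contra! hcon
          have := (h.large 1).trans (h.mono hcon)
          push_cast at this; omega
        have h1 := hsmall i (by omega)
        have h2 := hsmall j (by omega)
        have hr : 4 * rootCost m + 2 ≤ C [] := by
          have h4 : 4 ≤ 2 ^ m := by
            calc 4 = 2 ^ 2 := rfl
              _ ≤ 2 ^ m := Nat.pow_le_pow_right (by norm_num) (by omega)
          have h5 : 4 * (2 * rootCost m - 1) ≤ 2 ^ m * (2 * rootCost m - 1) :=
            Nat.mul_le_mul_right _ h4
          have h6 : 2 ^ m * (4 * rootCost m + 1) =
              2 ^ m * (2 * rootCost m - 1) + 2 ^ (m + 1) * rootCost m + 2 * 2 ^ m := by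
            obtain ⟨z, hz⟩ := Nat.exists_eq_add_of_le' hZ
            rw [hz, show 2 * (z + 1) - 1 = 2 * z + 1 by omega]; ring
          omega
        unfold edgeTransfer
        split_ifs <;> omega
      · have h1 := edgeTransfer_add_le (Z := rootCost m) (x := v - 1) (y := w)
          (by exact_mod_cast hZ) (by omega) (by omega)
        have hadd := h.add_le i j
        rcases le_total (2 * rootCost m) (C []) with hr | hr
        · have := edgeTransfer_nonneg (show 0 ≤ v - 1 + w + rootCost m by omega)
          omega
        · obtain ⟨e, he⟩ := Nat.exists_eq_add_of_le hr
          have hsize : leafThreshold m + 2 ^ m * (2 * rootCost m + 1 + e) ≤ i + j := by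
            have h2 : 2 ^ m * (4 * rootCost m + 1) =
                2 ^ m * (2 * rootCost m + 1 + e) + 2 ^ m * C [] := by
              rw [← mul_add]; congr 1; omega
            have h3 : 1 * C [] ≤ 2 ^ m * C [] := Nat.mul_le_mul_right _ hm1
            omega
          have h2 := (h.large _).trans (h.mono hsize)
          have h3 := edgeTransfer_mono (x := 2 * rootCost m + e) (y := v - 1 + w + rootCost m)
            (by push_cast at h2; omega)
          have h4 : edgeTransfer (2 * rootCost m + e) = (2 * rootCost m + e : ℤ) / 2 :=
            if_pos (by positivity)
          omega
    have hs : surplus (m + 1) C dominated = max _ (max _ _) := rfl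
    rw [hs]
    rcases le_total (canonicalSurplus m (branch C false)) (canonicalSurplus m (branch C true))
      with hle | hle
    · have h1 := key true hle
      have h2 := edgeTransfer_mono (hcan true).2
      have h3 := edgeTransfer_mono (hcan false).1
      rw [Bool.not_true] at h1
      exact le_max_of_le_right (le_max_of_le_right (by linarith))
    · have h1 := key false hle
      have h2 := edgeTransfer_mono (hcan false).2
      have h3 := edgeTransfer_mono (hcan true).1
      rw [Bool.not_false] at h1
      exact le_max_of_le_right (le_max_of_le_left (by linarith))
  · obtain ⟨ψ, h⟩ := exists_isGainBound hn
    have h1 := h.le_surplus C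
    have h2 := h.large 0
    rw [hC, solvableCount, if_neg h0, add_zero, Nat.add_sub_cancel] at h1
    rw [mul_zero, add_zero] at h2
    have h3 : canonicalSurplus n C ≤ surplus n C dominated := by
      unfold canonicalSurplus
      split_ifs
      · obtain ⟨m, rfl⟩ := Nat.exists_eq_add_of_le' (show 1 ≤ n by omega)
        exact le_max_left _ _
      · exact min_le_left _ _
      · omega
    push_cast at h2
    linarith

/-! ### A large unsolvable configuration -/

/-- One pebble on one leaf of each pair of sibling leaves. -/
def sparseConfig : ℕ → List Bool → ℕ
  | 0 => fun _ => 0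
  | 1 => graft 0 fun b _ => if b then 1 else 0
  | m + 2 => graft 0 fun _ => sparseConfig (m + 1)

/-- `s` pebbles on the leftmost leaf, and one pebble on one leaf of every other pair of sibling
leaves. -/
def stackedConfig (s : ℕ) : ℕ → List Bool → ℕ
  | 0 => fun _ => s
  | m + 1 => graft 0 fun b => if b then sparseConfig m else stackedConfig s m

theorem pebbleCount_sparseConfig (m : ℕ) : pebbleCount (m + 1) (sparseConfig (m + 1)) = 2 ^ m := by
  induction m with
  | zero => rfl
  | succ m ih =>
    rw [pebbleCount, sparseConfig, branch_graft, branch_graft, graft_nil, ih]; ring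

theorem pebbleCount_stackedConfig (s n : ℕ) :
    pebbleCount (n + 1) (stackedConfig s (n + 1)) + 1 = s + 2 ^ n := by
  induction n with
  | zero => simp [pebbleCount, stackedConfig, sparseConfig]
  | succ n ih =>
    rw [pebbleCount, stackedConfig, branch_graft, branch_graft, graft_nil, if_pos rfl,
      pebbleCount_sparseConfig]
    simp only [Bool.false_eq_true, if_false]
    rw [pow_succ]
    omega

theorem edgeTransfer_le_two_mul {x y : ℤ} (h : x ≤ y) : edgeTransfer x ≤ 2 * y := by
  unfold edgeTransfer; split_ifs <;> omega

theorem edgeTransfer_le_half {x y : ℤ} (h : x ≤ y) : edgeTransfer x ≤ y / 2 := by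
  unfold edgeTransfer; split_ifs <;> omega

/-- The wasted pebbles are worth nothing: a lone pebble on a leaf cannot move, and its sibling still
has to be dominated. The corrections charge for demands on the root that the canonical set does not
meet. -/
theorem surplus_sparseConfig_le (m : ℕ) :
    surplus (m + 1) (sparseConfig (m + 1)) free ≤ -(rootCost (m + 1) : ℤ) ∧
    surplus (m + 1) (sparseConfig (m + 1)) dominated ≤
      -(rootCost (m + 1) : ℤ) - (if (m + 1) % 3 = 0 then 1 else 0) ∧
    surplus (m + 1) (sparseConfig (m + 1)) pebbled ≤
      -(rootCost (m + 1) : ℤ) - (if (m + 1) % 3 = 1 then 0 else 1) := by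
  induction m with
  | zero => decide
  | succ m ih =>
    obtain ⟨h1, h2, h3⟩ := ih
    have hZ := one_le_rootCost m
    have e1 := edgeTransfer_le_two_mul h1
    have e2 := edgeTransfer_le_two_mul h2
    have e3 := edgeTransfer_le_two_mul h3
    rw [surplus, surplus, surplus, sparseConfig, branch_graft, branch_graft, graft_nil,
      rootCost, canonicalRoot]
    simp only [combineSurplus]
    generalize edgeTransfer (surplus (m + 1) (sparseConfig (m + 1)) free) = x,
      edgeTransfer (surplus (m + 1) (sparseConfig (m + 1)) dominated) = y,
      edgeTransfer (surplus (m + 1) (sparseConfig (m + 1)) pebbled) = z at *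
    rcases (by omega : (m + 1) % 3 = 0 ∨ (m + 1) % 3 = 1 ∨ (m + 1) % 3 = 2) with h | h | h
    · have h' : (m + 1 + 1) % 3 = 1 := by omega
      simp only [h, h'] at *
      norm_num at *
      omega
    · have h' : (m + 1 + 1) % 3 = 2 := by omega
      simp only [h, h'] at *
      norm_num at *
      omega
    · have h' : (m + 1 + 1) % 3 = 0 := by omega
      simp only [h, h'] at *
      norm_num at *
      omega

theorem surplus_stackedConfig_le (m s x : ℕ)
    (hs : s ≤ leafThreshold (m + 1) + 2 ^ (m + 1) * x) :
    surplus (m + 1) (stackedConfig s (m + 1)) free ≤ (x : ℤ) - 1 ∧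
    surplus (m + 1) (stackedConfig s (m + 1)) dominated ≤ (x : ℤ) - 1 ∧
    surplus (m + 1) (stackedConfig s (m + 1)) pebbled ≤
      (x : ℤ) - 1 - (if (m + 1) % 3 = 1 then 0 else 1) := by
  induction m generalizing x with
  | zero =>
    have hs' : s ≤ 1 + 2 * x := hs
    simp only [surplus, combineSurplus, stackedConfig, sparseConfig, branch_graft, graft_nil,
      edgeTransfer]
    norm_num
    split_ifs <;> omega
  | succ m ih =>
    have hZ := one_le_rootCost m
    -- Half of one less than this bound, rounded down, falls one short of paying for the sparse
    -- branch, the canonical root and `x`.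
    obtain ⟨h1, h2, h3⟩ := ih (2 * (2 * rootCost (m + 1) + canonicalRoot (m + 2) + x)) (by
      rw [leafThreshold_succ (by omega)] at hs
      refine hs.trans (le_of_eq ?_)
      rw [pow_succ 2 (m + 1)]; ring)
    obtain ⟨k1, k2, k3⟩ := surplus_sparseConfig_le m
    have e1 := edgeTransfer_le_half h1
    have e2 := edgeTransfer_le_half h2
    have e3 := edgeTransfer_le_half h3
    have f1 := edgeTransfer_le_two_mul k1
    have f2 := edgeTransfer_le_two_mul k2
    have f3 := edgeTransfer_le_two_mul k3
    rw [surplus, surplus, surplus, stackedConfig, branch_graft, branch_graft, graft_nil]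
    simp only [combineSurplus, Bool.false_eq_true, if_false, if_true]
    generalize edgeTransfer (surplus (m + 1) (sparseConfig (m + 1)) free) = u,
      edgeTransfer (surplus (m + 1) (sparseConfig (m + 1)) dominated) = v,
      edgeTransfer (surplus (m + 1) (sparseConfig (m + 1)) pebbled) = w,
      edgeTransfer (surplus (m + 1) (stackedConfig s (m + 1)) free) = u',
      edgeTransfer (surplus (m + 1) (stackedConfig s (m + 1)) dominated) = v',
      edgeTransfer (surplus (m + 1) (stackedConfig s (m + 1)) pebbled) = w' at *
    clear ih hs h1 h2 h3 k1 k2 k3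
    rcases (by omega : (m + 1) % 3 = 0 ∨ (m + 1) % 3 = 1 ∨ (m + 1) % 3 = 2) with h | h | h
    · have h' : (m + 2) % 3 = 1 := by omega
      simp only [h, h', canonicalRoot] at *
      norm_num at *
      omega
    · have h' : (m + 2) % 3 = 2 := by omega
      simp only [h, h', canonicalRoot] at *
      norm_num at *
      omega
    · have h' : (m + 2) % 3 = 0 := by omega
      simp only [h, h', canonicalRoot] at *
      norm_num at *
      omega

theorem exists_surplus_dominated_neg {n : ℕ} (hn : 2 ≤ n) :
    ∃ C, pebbleCount n C + 1 = solvableCount n ∧ surplus n C dominated < 0 := by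
  obtain ⟨m, rfl⟩ := Nat.exists_eq_add_of_le' hn
  by_cases h0 : (m + 2) % 3 = 0
  · refine ⟨stackedConfig (leafThreshold (m + 2) + 2 ^ (m + 1)) (m + 2), ?_, ?_⟩
    · rw [pebbleCount_stackedConfig, solvableCount, if_pos h0]; rfl
    · have hZ := one_le_rootCost m
      obtain ⟨h1, h2, h3⟩ := surplus_stackedConfig_le m (leafThreshold (m + 2) + 2 ^ (m + 1))
        -- With this value every strategy fails: the stacked branch can send up `2 * rootCost (m +
        -- 1)`, just the need of the sparse one, but has to give up a pebble of this if its own root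
        -- must be pebbled.
        (4 * rootCost (m + 1) + 1) (by
          rw [leafThreshold_succ (by omega), canonicalRoot, if_neg (by omega), pow_succ 2 (m + 1)]
          exact le_of_eq (by ring))
      obtain ⟨k1, k2, k3⟩ := surplus_sparseConfig_le m
      rw [if_neg (by omega)] at h3 k2 k3
      have e1 := edgeTransfer_le_half h1
      have e2 := edgeTransfer_le_half h2
      have e3 := edgeTransfer_le_half h3
      have f1 := edgeTransfer_le_two_mul k1
      have f2 := edgeTransfer_le_two_mul k2
      have f3 := edgeTransfer_le_two_mul k3
      rw [surplus, stackedConfig, branch_graft, branch_graft, graft_nil]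
      simp only [combineSurplus, Bool.false_eq_true, if_false, if_true]
      push_cast at *
      omega
  · refine ⟨stackedConfig (leafThreshold (m + 2)) (m + 2), ?_, ?_⟩
    · rw [pebbleCount_stackedConfig, solvableCount, if_neg h0]; rfl
    · have := (surplus_stackedConfig_le (m + 1) (leafThreshold (m + 2)) 0 (by simp)).2.1
      exact this.trans_lt (by norm_num)

/-! ### Monotonicity in the configuration and the value of the pebbling number -/

theorem surplus_mono {n : ℕ} {C D : List Bool → ℕ} (h : ∀ l, C l ≤ D l) (σ : RootState) :
    surplus n C σ ≤ surplus n D σ := by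
  induction n generalizing C D σ with
  | zero =>
    have := h []
    cases σ <;> simp only [surplus] <;> omega
  | succ n ih =>
    refine combineSurplus_mono 0 0 (fun τ => ?_) (fun τ => ?_) (by simpa using h []) σ <;>
    · rw [add_zero]
      exact edgeTransfer_mono (ih (fun l => h _) τ)

theorem HasDominationCoverSolution.mono {n : ℕ} {C D : BinaryTreeVertex n → ℕ}
    (h : HasDominationCoverSolution (completeBinaryTree n) C) (hCD : ∀ v, C v ≤ D v) :
    HasDominationCoverSolution (completeBinaryTree n) D := by
  have hext : ∀ E : BinaryTreeVertex n → ℕ, E = fun v => extendConfig E v.1 := fun E => by simp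
  rw [hext C, hasDominationCoverSolution_iff] at h
  rw [hext D, hasDominationCoverSolution_iff]
  refine h.trans (surplus_mono (fun l => ?_) _)
  unfold extendConfig
  split_ifs
  · exact hCD _
  · exact le_rfl

theorem exists_le_sum_eq {ι : Type*} [Fintype ι] (C : ι → ℕ) {M : ℕ} (h : M ≤ ∑ i, C i) :
    ∃ D : ι → ℕ, (∀ i, D i ≤ C i) ∧ ∑ i, D i = M := by
  classical
  induction M with
  | zero => exact ⟨fun _ => 0, by simp, by simp⟩
  | succ M ih =>
    obtain ⟨D, hD, hsum⟩ := ih (by omega)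
    obtain ⟨i, -, hi⟩ : ∃ i ∈ Finset.univ, D i < C i := by
      apply Finset.exists_lt_of_sum_lt
      omega
    refine ⟨D + Pi.single i 1, fun j => ?_, ?_⟩
    · by_cases hj : j = i
      · subst hj; simpa using hi
      · simpa [hj] using hD j
    · simp [Finset.sum_add_distrib, hsum]

theorem dominationCoverPebblingNumber_completeBinaryTree {n : ℕ} (hn : 2 ≤ n) :
    dominationCoverPebblingNumber (completeBinaryTree n) = solvableCount n := by
  have hmem : ∀ C : BinaryTreeVertex n → ℕ, ∑ v, C v = solvableCount n →
      HasDominationCoverSolution (completeBinaryTree n) C := by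
    intro C hC
    have hext : C = fun v => extendConfig C v.1 := by simp
    rw [hext, hasDominationCoverSolution_iff]
    apply surplus_dominated_nonneg hn
    rw [← sum_eq_pebbleCount]
    simpa using hC
  refine le_antisymm (Nat.sInf_le hmem) (le_csInf ⟨_, hmem⟩ fun M hM => ?_)
  -- The least `N` concerns configurations of exactly `N` pebbles, so each smaller `M` has to be
  -- excluded: some `M` pebbles of the bad configuration form an unsolvable one by monotonicity.
  by_contra! hlt
  obtain ⟨C, hC, hneg⟩ := exists_surplus_dominated_neg hn
  rw [← sum_eq_pebbleCount] at hC
  obtain ⟨D, hD, hsum⟩ := exists_le_sum_eq (fun v : BinaryTreeVertex n => C v.1)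
    (show M ≤ ∑ v : BinaryTreeVertex n, C v.1 by omega)
  exact hneg.not_ge ((hasDominationCoverSolution_iff n C).mp ((hM D hsum).mono hD))

/-! ### The closed form -/

/-- The cost, from a leaf, of the canonical dominating set in the half of the tree not containing
that leaf. -/
def farHalfCost (n : ℕ) : ℕ :=
  ∑ k ∈ Finset.Icc 1 ((n + 1) / 3), 2 ^ (n + 1 - 3 * k) * 2 ^ (2 * n + 2 - 3 * k)

/-- The cost, from a leaf, of the canonical dominating set in the half of the tree containing
that leaf. -/
def nearHalfCost (n : ℕ) : ℕ :=
  ∑ i ∈ Finset.range ((n - 1) / 3 + 1), (2 ^ (3 * i + 1)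
    + ∑ j ∈ Finset.Icc 1 (n - 3 * i - 2), 2 ^ (j - 1) * 2 ^ (3 * i + 2 * j + 1))

theorem sum_Icc_one (f : ℕ → ℕ) (N : ℕ) :
    ∑ k ∈ Finset.Icc 1 N, f k = ∑ k ∈ Finset.range N, f (k + 1) := by
  induction N with
  | zero => rfl
  | succ N ih => rw [Finset.sum_Icc_succ_top (by omega), Finset.sum_range_succ, ih]

theorem farHalfCost_add_three (n : ℕ) : farHalfCost (n + 3) = 8 ^ (n + 2) + 8 * farHalfCost n := by
  unfold farHalfCost
  rw [show (n + 3 + 1) / 3 = (n + 1) / 3 + 1 by omega, sum_Icc_one, sum_Icc_one,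
    Finset.sum_range_succ', Finset.mul_sum, add_comm]
  congr 1
  · rw [← pow_add, show (8 : ℕ) = 2 ^ 3 by norm_num, ← pow_mul]
    congr 1
    omega
  · refine Finset.sum_congr rfl fun k hk => ?_
    rw [Finset.mem_range] at hk
    rw [← pow_add, ← pow_add, show (8 : ℕ) = 2 ^ 3 by norm_num, ← pow_add]
    congr 1
    omega

theorem nearHalfCost_add_three {n : ℕ} (hn : 1 ≤ n) : nearHalfCost (n + 3) =
    2 + ∑ j ∈ Finset.range (n + 1), 8 ^ (j + 1) + 8 * nearHalfCost n := by
  unfold nearHalfCost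
  rw [show (n + 3 - 1) / 3 + 1 = (n - 1) / 3 + 1 + 1 by omega, Finset.sum_range_succ',
    Finset.mul_sum, add_comm]
  congr 1
  · rw [sum_Icc_one]
    congr 1
    refine Finset.sum_congr rfl fun j _ => ?_
    rw [← pow_add, show (8 : ℕ) = 2 ^ 3 by norm_num, ← pow_mul]
    congr 1
    omega
  · refine Finset.sum_congr rfl fun i _ => ?_
    rw [show n + 3 - 3 * (i + 1) - 2 = n - 3 * i - 2 by omega, mul_add 8, Finset.mul_sum]
    congr 1
    · ring
    · exact Finset.sum_congr rfl fun j _ => by ring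

/-- The near half of the larger tree is a whole copy of the smaller one; the root is counted with
the near half. The proof compares recurrences of period 3. -/
theorem nearHalfCost_succ : ∀ {n : ℕ}, 1 ≤ n →
    nearHalfCost (n + 1) = nearHalfCost n + farHalfCost n + 2 ^ (n + 1) * canonicalRoot (n + 1)
  | 1, _ => by decide
  | 2, _ => by decide
  | 3, _ => by decide
  | n + 4, _ => by
    have ih := nearHalfCost_succ (show 1 ≤ n + 1 by omega)
    have hc : canonicalRoot (n + 4 + 1) = canonicalRoot (n + 1 + 1) := by
      unfold canonicalRoot; congr 2; omega
    rw [show n + 4 + 1 = n + 2 + 3 by omega, nearHalfCost_add_three (by omega),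
      show n + 4 = n + 1 + 3 by omega, nearHalfCost_add_three (by omega), farHalfCost_add_three,
      Finset.sum_range_succ _ (n + 1 + 1), show n + 2 + 3 = n + 4 + 1 by omega, hc, ih]
    ring

theorem rootCost_add_three (n : ℕ) : rootCost (n + 4) = 4 ^ (n + 3) + rootCost (n + 1) := by
  induction n with
  | zero => decide
  | succ n ih =>
    have hc : canonicalRoot (n + 4 + 1) = canonicalRoot (n + 1 + 1) := by
      unfold canonicalRoot; congr 2; omega
    rw [show n + 1 + 4 = n + 4 + 1 by omega, rootCost, ih, rootCost.eq_2 (n + 1), hc]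
    ring

/-- Every far vertex costs `2 ^ (n + 1)` times as much from the leaf as from the root, and the far
half carries half of the root's cost once the root itself is removed. -/
theorem farHalfCost_eq : ∀ n : ℕ,
    farHalfCost (n + 1) + 2 ^ n * canonicalRoot (n + 1) = 2 ^ n * rootCost (n + 1)
  | 0 => by decide
  | 1 => by decide
  | 2 => by decide
  | n + 3 => by
    have ih := farHalfCost_eq n
    have hc : canonicalRoot (n + 3 + 1) = canonicalRoot (n + 1) := by
      unfold canonicalRoot; congr 2; omega
    rw [hc, show n + 3 + 1 = n + 1 + 3 by omega, farHalfCost_add_three,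
      show n + 1 + 3 = n + 4 by omega, rootCost_add_three, Nat.mul_add,
      show 2 ^ (n + 3) * rootCost (n + 1) = 8 * (2 ^ n * rootCost (n + 1)) by ring, ← ih,
      show (8 : ℕ) ^ (n + 1 + 2) = 2 ^ (n + 3) * 4 ^ (n + 3) by
        rw [← mul_pow]; norm_num]
    ring

theorem leafThreshold_add_one (n : ℕ) :
    leafThreshold (n + 1) + 1 = nearHalfCost (n + 1) + farHalfCost (n + 1) := by
  induction n with
  | zero => decide
  | succ n ih =>
    have h1 := farHalfCost_eq (n + 1)
    rw [rootCost, Nat.mul_add] at h1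
    have h2 := Nat.add_right_cancel h1
    rw [leafThreshold_succ (by omega), nearHalfCost_succ (by omega), h2, ← ih]
    ring

theorem theorem8 (n : ℕ) (hn : 2 ≤ n) :
    dominationCoverPebblingNumber (completeBinaryTree n) =
      (2 ^ (n - 1) - 1)
        + ∑ i ∈ Finset.range ((n - 1) / 3 + 1),
            (2 ^ (3 * i + 1)
              + ∑ j ∈ Finset.Icc 1 (n - 3 * i - 2), 2 ^ (j - 1) * 2 ^ (3 * i + 2 * j + 1))
        + ∑ k ∈ Finset.Icc 1 ((n + 1) / 3), 2 ^ (n + 1 - 3 * k) * 2 ^ (2 * n + 2 - 3 * k)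
        + (if n % 3 = 0 then 2 ^ (n - 1) else 0) := by
  rw [dominationCoverPebblingNumber_completeBinaryTree hn, solvableCount]
  obtain ⟨m, rfl⟩ := Nat.exists_eq_add_of_le' (show 1 ≤ n by omega)
  have h1 := leafThreshold_add_one m
  have h2 : 1 ≤ 2 ^ (m + 1 - 1) := Nat.one_le_two_pow
  unfold nearHalfCost farHalfCost at h1
  omega
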